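/- **Theorem 2.6.** Let $a$ be a nonzero real number and let $m_1,m_2,m_3\in\mathbb N=\{0,1,2,\dots\}$. For $0\ne b\in\mathbb C$ and $i\in\mathbb N$ put $\xi_{b,0}(t)=1$, $\xi_{b,1}(t)=t/b$ and, for $i\ge 2$, $$\xi_{b,i}(t)=\frac{t^i}{i!\,b^i}-\frac{t^{i-1}}{(i-2)!\,b^{i+1}}+\sum_{r=2}^{i-1}\frac{(-1)^r\prod_{s=1}^{r-1}(i+s)}{(i-r-1)!\,r!\,b^{r+i}}\,t^{i-r}.$$ For real $t$ let $\zeta_{i,0}(t)$ and $\zeta_{i,1}(t)$ be the real and imaginary parts of $\xi_{2a\sqrt{-1},i}(t)$, so that $\xi_{2a\sqrt{-1},i}=\zeta_{i,0}+\zeta_{i,1}\sqrt{-1}$. For $\alpha=(\alpha_1,\dots,\alpha_{11})\in\mathbb N^{11}$ put $\alpha!=\prod_{i=1}^{11}\alpha_i!$, $$|\alpha|_1=\sum_{i=1}^{7}i\alpha_i+\alpha_8+2\alpha_9+3\alpha_{10}+\alpha_{11},$$ and define the differential operator $d_\alpha$ on $\mathbb R[x,y,z]$ by $$\begin{aligne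d}d_\alpha={}&\frac{|\alpha|_1!}{\alpha!}\,2^{-\alpha_4}\,3^{-\alpha_3-\alpha_4-\alpha_5-2\alpha_6-2\alpha_7-\alpha_{10}}\,7^{-\alpha_7}\;x^{\alpha_8+\alpha_9+\alpha_{10}}\,y^{\alpha_{11}}\\&\times\partial_x^{2\alpha_1+\alpha_2}\,\partial_y^{2(\alpha_2+\alpha_5+\alpha_8)+\alpha_6+\alpha_9}\,\partial_z^{2(2\alpha_5+3\alpha_6+4\alpha_7+\alpha_9+2\alpha_{10}+\alpha_{11})}\\&\times(\partial_y^4+2\partial_x\partial_y\partial_z^2)^{\alpha_3}\,(3\partial_y^3\partial_z^2+\partial_x\partial_z^4)^{\alpha_4}.\end{aligned}$$ Then $d_\alpha(x^{m_1}y^{m_2}z^{m_3})\ne 0$ for only finitely many $\alpha\in\mathbb N^{11}$, so that $$P=\sum_{\alpha\in\mathbb N^{11}}\zeta_{|\alpha|_1,0}(t)\,d_\alpha(x^{m_1}y^{m_2}z^{m_3}),\qquad Q=\sum_{\alpha\in\mathbb N^{11}}\zeta_{|\alpha|_1,1}(t)\,d_\alpha(x^{m_1}y^{m_2}z^{m_3})$$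 are finite sums; they are real polynomials in $t,x,y,z$, and the two functions $$u=\cos(at)\,P-\sin(at)\,Q,\qquad u=\sin(at)\,P+\cos(at)\,Q$$ are smooth real solutions on all of $\mathbb R^4$ of the generalized Klein–Gordon equation $$u_{tt}-u_{xx}-x\,u_{yy}-y\,u_{zz}+a^2u=0.$$ -/

import Mathlib

open scoped Nat ContDiff
open MvPolynomial

namespace KleinGordon

/-- The polynomial function `ξ_{b,i}(t)`
`= t^i/(i! b^i) - t^(i-1)/((i-2)! b^(i+1))`
`+ ∑_{r=2}^{i-1} (-1)^r (i+1)⋯(i+r-1) / ((i-r-1)! r! b^(r+i)) t^(i-r)`.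
The middle term is the summand `r = 1`.  For `i = 0` and `i = 1` the sum is empty, which gives
`ξ_{b,0} = 1` and `ξ_{b,1} = t/b`. -/
noncomputable def xi (b : ℂ) (i : ℕ) (t : ℂ) : ℂ :=
  t ^ i / ((i ! : ℂ) * b ^ i) +
    ∑ r ∈ Finset.Icc 1 (i - 1),
      (-1) ^ r * (∏ s ∈ Finset.Icc 1 (r - 1), ((i : ℂ) + (s : ℂ))) /
        (((i - r - 1)! : ℂ) * (r ! : ℂ) * b ^ (r + i)) * t ^ (i - r)

/-- `ζ_{i,0}(t)`, the real part of `ξ_{2a√-1,i}(t)` for real `t`. -/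
noncomputable def zeta0 (a : ℝ) (i : ℕ) (t : ℝ) : ℝ :=
  (xi (2 * (a : ℂ) * Complex.I) i (t : ℂ)).re

/-- `ζ_{i,1}(t)`, the imaginary part of `ξ_{2a√-1,i}(t)` for real `t`. -/
noncomputable def zeta1 (a : ℝ) (i : ℕ) (t : ℝ) : ℝ :=
  (xi (2 * (a : ℂ) * Complex.I) i (t : ℂ)).im

/-- `|α|₁`; the entry `α_j` of the multi-index is `α (j - 1)`. -/
def weight (α : Fin 11 → ℕ) : ℕ :=
  α 0 + 2 * α 1 + 3 * α 2 + 4 * α 3 + 5 * α 4 + 6 * α 5 + 7 * α 6 +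
    α 7 + 2 * α 8 + 3 * α 9 + α 10

/-- Real polynomials in `x = X 0`, `y = X 1`, `z = X 2`. -/
abbrev Poly3 : Type := MvPolynomial (Fin 3) ℝ

/-- The partial derivative `∂_x`, `∂_y`, `∂_z` for `j = 0, 1, 2`, as a linear operator on
polynomials; products and powers of operators are compositions. -/
noncomputable def D (j : Fin 3) : Module.End ℝ Poly3 :=
  (pderiv j : Derivation ℝ Poly3 Poly3).toLinearMap

/-- The coefficient
`(|α|₁! / α!) 2^(-α₄) 3^(-α₃-α₄-α₅-2α₆-2α₇-α₁₀) 7^(-α₇)` of `d_α`. -/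
noncomputable def dCoeff (α : Fin 11 → ℕ) : ℝ :=
  ((weight α)! : ℝ) / (∏ j, ((α j)! : ℝ)) /
    (2 ^ α 3 * 3 ^ (α 2 + α 3 + α 4 + 2 * α 5 + 2 * α 6 + α 9) * 7 ^ α 6)

/-- The operator `d_α`:  `dCoeff α` times
`x^(α₈+α₉+α₁₀) y^(α₁₁) ∂_x^(2α₁+α₂) ∂_y^(2(α₂+α₅+α₈)+α₆+α₉)`
`∂_z^(2(2α₅+3α₆+4α₇+α₉+2α₁₀+α₁₁))`
`(∂_y⁴ + 2∂_x∂_y∂_z²)^(α₃) (3∂_y³∂_z² + ∂_x∂_z⁴)^(α₄)`. -/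
noncomputable def dOp (α : Fin 11 → ℕ) : Module.End ℝ Poly3 :=
  dCoeff α •
    (LinearMap.mulLeft ℝ ((X 0 : Poly3) ^ (α 7 + α 8 + α 9) * (X 1 : Poly3) ^ α 10) *
      D 0 ^ (2 * α 0 + α 1) *
      D 1 ^ (2 * (α 1 + α 4 + α 7) + α 5 + α 8) *
      D 2 ^ (2 * (2 * α 4 + 3 * α 5 + 4 * α 6 + α 8 + 2 * α 9 + α 10)) *
      (D 1 ^ 4 + (2 : ℝ) • (D 0 * D 1 * D 2 ^ 2)) ^ α 2 *
      ((3 : ℝ) • (D 1 ^ 3 * D 2 ^ 2) + D 0 * D 2 ^ 4) ^ α 3)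

/-- The polynomial `d_α(x^m₁ y^m₂ z^m₃)`. -/
noncomputable def dMon (m₁ m₂ m₃ : ℕ) (α : Fin 11 → ℕ) : Poly3 :=
  dOp α ((X 0 : Poly3) ^ m₁ * (X 1 : Poly3) ^ m₂ * (X 2 : Poly3) ^ m₃)

/-- `P = ∑_α ζ_{|α|₁,0}(t) d_α(x^m₁ y^m₂ z^m₃)`. -/
noncomputable def P (a : ℝ) (m₁ m₂ m₃ : ℕ) (t x y z : ℝ) : ℝ :=
  ∑ᶠ α : Fin 11 → ℕ, zeta0 a (weight α) t * eval ![x, y, z] (dMon m₁ m₂ m₃ α)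

/-- `Q = ∑_α ζ_{|α|₁,1}(t) d_α(x^m₁ y^m₂ z^m₃)`. -/
noncomputable def Q (a : ℝ) (m₁ m₂ m₃ : ℕ) (t x y z : ℝ) : ℝ :=
  ∑ᶠ α : Fin 11 → ℕ, zeta1 a (weight α) t * eval ![x, y, z] (dMon m₁ m₂ m₃ α)

/-- `u` is a smooth solution on all of `ℝ⁴` of
`u_tt - u_xx - x u_yy - y u_zz + a² u = 0`. -/
def IsSolution (a : ℝ) (u : ℝ → ℝ → ℝ → ℝ → ℝ) : Prop :=
  ContDiff ℝ ∞ (fun p : ℝ × ℝ × ℝ × ℝ => u p.1 p.2.1 p.2.2.1 p.2.2.2) ∧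
  ∀ t x y z : ℝ,
    iteratedDeriv 2 (fun s => u s x y z) t - iteratedDeriv 2 (fun s => u t s y z) x -
      x * iteratedDeriv 2 (fun s => u t x s z) y -
      y * iteratedDeriv 2 (fun s => u t x y s) z + a ^ 2 * u t x y z = 0

end KleinGordon

namespace KleinGordon

theorem derivation_prod {ι A : Type*} [DecidableEq ι] [CommRing A] [Algebra ℝ A]
    (d : Derivation ℝ A A) (s : Finset ι) (f : ι → A) :
    d (∏ i ∈ s, f i) = ∑ j ∈ s, d (f j) * ∏ i ∈ s.erase j, f i := by
  induction s using Finset.induction_on with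
  | empty => simp
  | insert a s ha ih =>
    rw [Finset.prod_insert ha, Derivation.leibniz, ih, Finset.sum_insert ha,
      Finset.erase_insert ha, smul_eq_mul, smul_eq_mul, Finset.mul_sum, add_comm,
      mul_comm (d (f a))]
    congr 1
    refine Finset.sum_congr rfl fun j hj => ?_
    have hne : a ≠ j := fun h => ha (h ▸ hj)
    rw [Finset.erase_insert_of_ne hne,
      Finset.prod_insert (fun h => ha (Finset.mem_of_mem_erase h))]
    ring

section DividedPowers

variable {ι A : Type*} [Fintype ι] [DecidableEq ι] [CommRing A] [Algebra ℝ A]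

/-- The multi-indices `α` with `∑ w_j α_j = k`. -/
def level (w : ι → ℕ) (k : ℤ) : Finset (ι → ℕ) :=
  (Fintype.piFinset fun _ => Finset.range (k.toNat + 1)).filter
    fun α => ((∑ j, w j * α j : ℕ) : ℤ) = k

theorem mem_level {w : ι → ℕ} (hw : ∀ j, 0 < w j) {k : ℤ} {α : ι → ℕ} :
    α ∈ level w k ↔ ((∑ j, w j * α j : ℕ) : ℤ) = k := by
  simp only [level, Finset.mem_filter, Fintype.mem_piFinset, Finset.mem_range,
    and_iff_right_iff_imp]
  intro h j
  have h1 : w j * α j ≤ ∑ i, w i * α i :=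
    Finset.single_le_sum (f := fun i => w i * α i) (fun _ _ => Nat.zero_le _) (Finset.mem_univ j)
  have h2 : α j ≤ w j * α j := Nat.le_mul_of_pos_left _ (hw j)
  omega

theorem weight_add_single (w : ι → ℕ) (β : ι → ℕ) (j : ι) :
    ∑ i, w i * (β + Pi.single j 1 : ι → ℕ) i = ∑ i, w i * β i + w j := by
  simp [mul_add, Finset.sum_add_distrib, Pi.single_apply]

theorem sum_level_shift {M : Type*} [AddCommMonoid M] {w : ι → ℕ} (hw : ∀ j, 0 < w j) (k : ℤ)
    (j : ι) (F : (ι → ℕ) → M) (hF : ∀ α, α j = 0 → F α = 0) :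
    ∑ α ∈ level w k, F α = ∑ β ∈ level w (k - w j), F (β + Pi.single j 1) := by
  symm
  refine Finset.sum_of_injOn (fun β : ι → ℕ => β + Pi.single j 1)
    (fun _ _ _ _ h => add_right_cancel h) ?_ ?_ (fun _ _ => rfl)
  · intro β hβ
    rw [Finset.mem_coe, mem_level hw] at hβ ⊢
    simp only [weight_add_single]
    push_cast at hβ ⊢
    linarith
  · intro α hα hne
    apply hF
    by_contra h0
    have hαe : α - Pi.single j 1 + Pi.single j 1 = α := by
      funext i
      by_cases hij : i = j
      · subst hij
        simp
        omega
      · simp [hij]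
    refine hne ⟨α - Pi.single j 1, ?_, hαe⟩
    rw [mem_level hw] at hα
    rw [Finset.mem_coe, mem_level hw]
    rw [← hαe, weight_add_single] at hα
    push_cast at hα ⊢
    linarith

/-- The divided-power monomial `∏ τ_j^α_j / α_j!`. -/
noncomputable def divMon (τ : ι → A) (α : ι → ℕ) : A :=
  ∏ j, ((α j)! : ℝ)⁻¹ • τ j ^ α j

theorem divMon_eq_mul_erase (τ : ι → A) (α : ι → ℕ) (j : ι) :
    divMon τ α = (((α j)! : ℝ)⁻¹ • τ j ^ α j) *
      ∏ i ∈ Finset.univ.erase j, ((α i)! : ℝ)⁻¹ • τ i ^ α i :=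
  (Finset.mul_prod_erase _ _ (Finset.mem_univ j)).symm

theorem erase_add_single (τ : ι → A) (β : ι → ℕ) (j : ι) :
    ∏ i ∈ Finset.univ.erase j,
        (((β + Pi.single j 1 : ι → ℕ) i)! : ℝ)⁻¹ • τ i ^ (β + Pi.single j 1 : ι → ℕ) i =
      ∏ i ∈ Finset.univ.erase j, ((β i)! : ℝ)⁻¹ • τ i ^ β i := by
  refine Finset.prod_congr rfl fun i hi => ?_
  simp [Finset.ne_of_mem_erase hi]

theorem smul_divMon_add_single (τ : ι → A) (β : ι → ℕ) (j : ι) :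
    ((β j + 1 : ℕ) : ℝ) • divMon τ (β + Pi.single j 1) = τ j * divMon τ β := by
  rw [divMon_eq_mul_erase τ _ j, erase_add_single, divMon_eq_mul_erase τ β j]
  have h : ((β j + 1 : ℕ) : ℝ) ≠ 0 := by positivity
  have h' : ((β j)! : ℝ) ≠ 0 := by positivity
  rw [← mul_assoc, ← smul_mul_assoc, smul_smul, mul_smul_comm]
  congr 1
  simp only [Pi.add_apply, Pi.single_eq_same, Nat.factorial_succ, pow_succ']
  congr 1
  push_cast at h ⊢
  field_simp

/-- The part of weight `k` of `exp (∑ τ_j)`. -/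
noncomputable def expPart (w : ι → ℕ) (τ : ι → A) (k : ℤ) : A :=
  ∑ α ∈ level w k, divMon τ α

theorem derivation_expPart {w : ι → ℕ} (hw : ∀ j, 0 < w j) (τ : ι → A) (d : Derivation ℝ A A)
    (k : ℤ) : d (expPart w τ k) = ∑ j, d (τ j) * expPart w τ (k - w j) := by
  simp only [expPart, map_sum, divMon, derivation_prod]
  rw [Finset.sum_comm]
  refine Finset.sum_congr rfl fun j _ => ?_
  rw [sum_level_shift hw k j, Finset.mul_sum]
  · refine Finset.sum_congr rfl fun β _ => ?_
    have h := divMon_eq_mul_erase τ β j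
    rw [divMon] at h
    rw [h, erase_add_single, ← mul_assoc]
    congr 1
    have h : ((β j : ℝ) + 1) ≠ 0 := by positivity
    have h' : ((β j)! : ℝ) ≠ 0 := by positivity
    simp only [Pi.add_apply, Pi.single_eq_same, Nat.factorial_succ, Derivation.map_smul,
      Derivation.leibniz_pow, Nat.add_sub_cancel, mul_smul_comm]
    rw [← Nat.cast_smul_eq_nsmul ℝ, smul_smul, smul_eq_mul, mul_comm (τ j ^ β j)]
    congr 1
    push_cast
    field_simp
  · intro α hα
    simp [hα]

theorem smul_expPart {w : ι → ℕ} (hw : ∀ j, 0 < w j) (τ : ι → A) (k : ℤ) :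
    (k : ℝ) • expPart w τ k = ∑ j, (w j : ℝ) • (τ j * expPart w τ (k - w j)) := by
  have h1 : (k : ℝ) • expPart w τ k =
      ∑ α ∈ level w k, ∑ j, (w j : ℝ) • ((α j : ℝ) • divMon τ α) := by
    rw [expPart, Finset.smul_sum]
    refine Finset.sum_congr rfl fun α hα => ?_
    rw [mem_level hw] at hα
    simp only [smul_smul]
    rw [← Finset.sum_smul, ← hα]
    push_cast
    rfl
  rw [h1, Finset.sum_comm]
  refine Finset.sum_congr rfl fun j _ => ?_
  rw [← Finset.smul_sum, sum_level_shift hw k j (fun α => (α j : ℝ) • divMon τ α)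
    (fun α h => by simp [h]), expPart, Finset.mul_sum]
  congr 1
  refine Finset.sum_congr rfl fun β _ => ?_
  rw [← smul_divMon_add_single]
  simp

end DividedPowers

theorem D_commute (i j : Fin 3) : D i * D j = D j * D i := by
  have h : ∀ p : Poly3, D i (D j p) = D j (D i p) := by
    intro p
    induction p using MvPolynomial.induction_on' with
    | monomial m c =>
      simp only [D, Derivation.coeFn_coe, pderiv_monomial]
      by_cases hij : i = j
      · rw [hij]
      · have h1 : (Finsupp.single i 1 : Fin 3 →₀ ℕ) j = 0 := by simp [hij]
        have h2 : (Finsupp.single j 1 : Fin 3 →₀ ℕ) i = 0 := by simp [Ne.symm hij]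
        simp only [Finsupp.tsub_apply, h1, h2, tsub_zero]
        rw [tsub_right_comm, mul_right_comm]
    | add p q hp hq => simp [hp, hq]
  exact LinearMap.ext h

/-- Normal-ordered quantization of symbols in `x, y, ξ, η, ζ`: the coordinates act by
multiplication on the left of the derivatives. -/
noncomputable def quant : MvPolynomial (Fin 5) ℝ →ₗ[ℝ] Module.End ℝ Poly3 :=
  (basisMonomials (Fin 5) ℝ).constr ℝ fun m =>
    LinearMap.mulLeft ℝ ((X 0 : Poly3) ^ m 0 * (X 1 : Poly3) ^ m 1) *
      (D 0 ^ m 2 * D 1 ^ m 3 * D 2 ^ m 4)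

theorem quant_monomial (m : Fin 5 →₀ ℕ) (c : ℝ) :
    quant (monomial m c) = c • (LinearMap.mulLeft ℝ ((X 0 : Poly3) ^ m 0 * (X 1 : Poly3) ^ m 1) *
      (D 0 ^ m 2 * D 1 ^ m 3 * D 2 ^ m 4)) := by
  have h : monomial m c = c • basisMonomials (Fin 5) ℝ m := by
    simp [coe_basisMonomials, smul_monomial]
  rw [h, map_smul, quant, Module.Basis.constr_basis]

theorem quant_one : quant 1 = 1 := by
  have h := quant_monomial 0 1
  simpa [LinearMap.mulLeft_one, ← Module.End.one_eq_id] using h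

theorem X_mul_monomial' (i : Fin 5) (m : Fin 5 →₀ ℕ) (c : ℝ) :
    (X i * monomial m c : MvPolynomial (Fin 5) ℝ) = monomial (Finsupp.single i 1 + m) c := by
  simp [X, monomial_mul]

theorem quant_X_zero_mul (σ : MvPolynomial (Fin 5) ℝ) :
    quant (X 0 * σ) = LinearMap.mulLeft ℝ (X 0) * quant σ := by
  induction σ using MvPolynomial.induction_on' with
  | monomial m c =>
    rw [X_mul_monomial', quant_monomial, quant_monomial, mul_smul_comm,
      ← mul_assoc (LinearMap.mulLeft ℝ _) (LinearMap.mulLeft ℝ _),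
      Module.End.mul_eq_comp (LinearMap.mulLeft ℝ _) (LinearMap.mulLeft ℝ _),
      ← LinearMap.mulLeft_mul]
    simp [pow_add, mul_assoc]
  | add p q hp hq => rw [mul_add, map_add, hp, hq, map_add, mul_add]

theorem quant_X_one_mul (σ : MvPolynomial (Fin 5) ℝ) :
    quant (X 1 * σ) = LinearMap.mulLeft ℝ (X 1) * quant σ := by
  induction σ using MvPolynomial.induction_on' with
  | monomial m c =>
    rw [X_mul_monomial', quant_monomial, quant_monomial, mul_smul_comm,
      ← mul_assoc (LinearMap.mulLeft ℝ _) (LinearMap.mulLeft ℝ _),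
      Module.End.mul_eq_comp (LinearMap.mulLeft ℝ _) (LinearMap.mulLeft ℝ _),
      ← LinearMap.mulLeft_mul]
    simp [pow_add, mul_left_comm]
  | add p q hp hq => rw [mul_add, map_add, hp, hq, map_add, mul_add]

theorem D_pow_mul (i j : Fin 3) (n : ℕ) : D i ^ n * D j = D j * D i ^ n :=
  (Commute.pow_left (D_commute i j) n).eq

theorem quant_X_two_mul (σ : MvPolynomial (Fin 5) ℝ) : quant (X 2 * σ) = quant σ * D 0 := by
  induction σ using MvPolynomial.induction_on' with
  | monomial m c =>
    rw [X_mul_monomial', quant_monomial, quant_monomial, smul_mul_assoc, mul_assoc _ _ (D 0)]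
    simp only [mul_assoc]
    rw [D_pow_mul 2 0, ← mul_assoc (D 1 ^ _) (D 0), D_pow_mul 1 0, mul_assoc (D 0),
       ← mul_assoc (D 0 ^ _) (D 0), ← pow_succ]
    simp [add_comm]
  | add p q hp hq => rw [mul_add, map_add, hp, hq, map_add, add_mul]

theorem quant_X_three_mul (σ : MvPolynomial (Fin 5) ℝ) : quant (X 3 * σ) = quant σ * D 1 := by
  induction σ using MvPolynomial.induction_on' with
  | monomial m c =>
    rw [X_mul_monomial', quant_monomial, quant_monomial, smul_mul_assoc, mul_assoc _ _ (D 1)]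
    simp only [mul_assoc]
    rw [D_pow_mul 2 1, ← mul_assoc (D 1 ^ _) (D 1), ← pow_succ]
    simp [add_comm]
  | add p q hp hq => rw [mul_add, map_add, hp, hq, map_add, add_mul]

theorem quant_X_four_mul (σ : MvPolynomial (Fin 5) ℝ) : quant (X 4 * σ) = quant σ * D 2 := by
  induction σ using MvPolynomial.induction_on' with
  | monomial m c =>
    rw [X_mul_monomial', quant_monomial, quant_monomial, smul_mul_assoc, mul_assoc _ _ (D 2)]
    simp only [mul_assoc]
    rw [← pow_succ]
    simp [add_comm]
  | add p q hp hq => rw [mul_add, map_add, hp, hq, map_add, add_mul]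

theorem D_mul_mulLeft (i : Fin 3) (p : Poly3) :
    D i * LinearMap.mulLeft ℝ p = LinearMap.mulLeft ℝ (D i p) + LinearMap.mulLeft ℝ p * D i := by
  refine LinearMap.ext fun f => ?_
  simp [D, Derivation.leibniz]
  ring

theorem mulLeft_smul (c : ℝ) (p : Poly3) :
    LinearMap.mulLeft ℝ (c • p) = c • LinearMap.mulLeft ℝ p :=
  map_smul (LinearMap.mul ℝ Poly3) c p

theorem quant_pderiv_zero (σ : MvPolynomial (Fin 5) ℝ) :
    D 0 * quant σ = quant (pderiv 0 σ + X 2 * σ) := by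
  rw [map_add, quant_X_two_mul]
  induction σ using MvPolynomial.induction_on' with
  | monomial m c =>
    rw [← quant_X_two_mul, X_mul_monomial', pderiv_monomial, quant_monomial, quant_monomial,
      quant_monomial, mul_smul_comm, ← mul_assoc, D_mul_mulLeft, mul_comm c, mul_smul,
      smul_comm _ c, ← smul_add, add_mul]
    congr 1
    have : D 0 ((X 0 : Poly3) ^ m 0 * X 1 ^ m 1) =
      (m 0 : ℝ) • ((X 0 : Poly3) ^ (m 0 - 1) * X 1 ^ m 1) := by
      simp [D, Derivation.leibniz, Derivation.leibniz_pow, smul_eq_C_mul]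
      ring
    rw [this]
    congr 1
    · simp [mulLeft_smul]
    · simp [pow_add, mul_assoc]
  | add p q hp hq => rw [map_add, mul_add, hp, hq, map_add, map_add, add_mul]; abel

theorem quant_pderiv_one (σ : MvPolynomial (Fin 5) ℝ) :
    D 1 * quant σ = quant (pderiv 1 σ + X 3 * σ) := by
  rw [map_add, quant_X_three_mul]
  induction σ using MvPolynomial.induction_on' with
  | monomial m c =>
    rw [← quant_X_three_mul, X_mul_monomial', pderiv_monomial, quant_monomial, quant_monomial,
      quant_monomial, mul_smul_comm, ← mul_assoc, D_mul_mulLeft, mul_comm c, mul_smul,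
      smul_comm _ c, ← smul_add, add_mul]
    congr 1
    have : D 1 ((X 0 : Poly3) ^ m 0 * X 1 ^ m 1) =
      (m 1 : ℝ) • ((X 0 : Poly3) ^ m 0 * X 1 ^ (m 1 - 1)) := by
      simp [D, Derivation.leibniz, Derivation.leibniz_pow, smul_eq_C_mul]
      ring
    rw [this]
    congr 1
    · simp [mulLeft_smul]
    · rw [mul_assoc _ (D 1), ← mul_assoc (D 1), ← mul_assoc (D 1), ← D_pow_mul 0 1]
      simp [pow_add, mul_assoc]
  | add p q hp hq => rw [map_add, mul_add, hp, hq, map_add, map_add, add_mul]; abel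

theorem quant_pderiv_two (σ : MvPolynomial (Fin 5) ℝ) :
    D 2 * quant σ = quant (X 4 * σ) := by
  rw [quant_X_four_mul]
  induction σ using MvPolynomial.induction_on' with
  | monomial m c =>
    rw [quant_monomial, mul_smul_comm, ← mul_assoc, D_mul_mulLeft, smul_mul_assoc, add_mul]
    congr 1
    have : D 2 ((X 0 : Poly3) ^ m 0 * X 1 ^ m 1) = 0 := by
      simp [D, Derivation.leibniz, Derivation.leibniz_pow]
    rw [this]
    simp only [LinearMap.mulLeft_zero_eq_zero, zero_mul, zero_add, mul_assoc]
    rw [D_pow_mul 2 2, ← mul_assoc (D 1 ^ _) (D 2), D_pow_mul 1 2, mul_assoc (D 2),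
       ← mul_assoc (D 0 ^ _) (D 2), D_pow_mul 0 2, mul_assoc (D 2)]
  | add p q hp hq => rw [map_add, mul_add, hp, hq, add_mul]

/-- The symbols of the eleven elementary operators. -/
noncomputable def tau : Fin 11 → MvPolynomial (Fin 5) ℝ :=
  ![X 2 ^ 2, X 2 * X 3 ^ 2, (1 / 3 : ℝ) • (X 3 ^ 4 + (2 : ℝ) • (X 2 * X 3 * X 4 ^ 2)),
    (1 / 6 : ℝ) • ((3 : ℝ) • (X 3 ^ 3 * X 4 ^ 2) + X 2 * X 4 ^ 4),
    (1 / 3 : ℝ) • (X 3 ^ 2 * X 4 ^ 4),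
    (1 / 9 : ℝ) • (X 3 * X 4 ^ 6), (1 / 63 : ℝ) • X 4 ^ 8, X 0 * X 3 ^ 2,
    X 0 * X 3 * X 4 ^ 2, (1 / 3 : ℝ) • (X 0 * X 4 ^ 4), X 1 * X 4 ^ 2]

/-- The weights of the eleven elementary operators. -/
def wt : Fin 11 → ℕ := ![1, 2, 3, 4, 5, 6, 7, 1, 2, 3, 1]

theorem wt_pos : ∀ j, 0 < wt j := by decide

theorem weight_eq_sum (α : Fin 11 → ℕ) : weight α = ∑ j, wt j * α j := by
  simp [weight, Fin.sum_univ_succ, wt]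
  ring

/-- The spatial operator `∂_x² + x ∂_y² + y ∂_z²`. -/
noncomputable def spatial : Module.End ℝ Poly3 :=
  D 0 ^ 2 + LinearMap.mulLeft ℝ (X 0) * D 1 ^ 2 + LinearMap.mulLeft ℝ (X 1) * D 2 ^ 2

theorem pderiv_zero_expPart (k : ℤ) :
    pderiv 0 (expPart wt tau k) = X 3 ^ 2 * expPart wt tau (k - 1) +
      X 3 * X 4 ^ 2 * expPart wt tau (k - 2) +
      (1 / 3 : ℝ) • (X 4 ^ 4 * expPart wt tau (k - 3)) := by
  rw [derivation_expPart wt_pos]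
  generalize expPart wt tau = G
  simp [Fin.sum_univ_succ, tau, wt, Derivation.leibniz, Derivation.leibniz_pow, pderiv_X]
  algebra

theorem pderiv_one_expPart (k : ℤ) :
    pderiv 1 (expPart wt tau k) = X 4 ^ 2 * expPart wt tau (k - 1) := by
  rw [derivation_expPart wt_pos]
  generalize expPart wt tau = G
  simp [Fin.sum_univ_succ, tau, wt, Derivation.leibniz, Derivation.leibniz_pow, pderiv_X]

theorem spatial_mul_quant_expPart (k : ℤ) :
    spatial * quant (expPart wt tau k) = ((k + 1 : ℤ) : ℝ) • quant (expPart wt tau (k + 1)) := by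
  rw [spatial, add_mul, add_mul, mul_assoc, mul_assoc, pow_two, pow_two, pow_two, mul_assoc,
    mul_assoc,
    mul_assoc, quant_pderiv_zero, quant_pderiv_zero, quant_pderiv_one, quant_pderiv_one,
    quant_pderiv_two, quant_pderiv_two, ← quant_X_zero_mul, ← quant_X_one_mul, ← map_add,
    ← map_add, ← map_smul]
  congr 1
  rw [smul_expPart wt_pos]
  simp only [map_add, Derivation.leibniz, pderiv_zero_expPart,
    pderiv_one_expPart, Derivation.map_smul, Derivation.leibniz_pow]
  generalize expPart wt tau = G
  simp [Fin.sum_univ_succ, tau, wt, pderiv_X, sub_sub, add_sub_assoc]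
  algebra

theorem quant_pow_mul_right {q : MvPolynomial (Fin 5) ℝ} {T : Module.End ℝ Poly3}
    (h : ∀ σ, quant (q * σ) = quant σ * T) (n : ℕ) (σ : MvPolynomial (Fin 5) ℝ) :
    quant (q ^ n * σ) = quant σ * T ^ n := by
  induction n generalizing σ with
  | zero => simp
  | succ n ih => rw [pow_succ, mul_assoc, ih, h, mul_assoc, ← pow_succ']

theorem quant_pow_mul_left {q : MvPolynomial (Fin 5) ℝ} {T : Module.End ℝ Poly3}
    (h : ∀ σ, quant (q * σ) = T * quant σ) (n : ℕ) (σ : MvPolynomial (Fin 5) ℝ) :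
    quant (q ^ n * σ) = T ^ n * quant σ := by
  induction n generalizing σ with
  | zero => simp
  | succ n ih => rw [pow_succ, mul_assoc, ih, h, ← mul_assoc, ← pow_succ]

theorem quant_tau_two_mul (σ : MvPolynomial (Fin 5) ℝ) :
    quant ((X 3 ^ 4 + (2 : ℝ) • (X 2 * X 3 * X 4 ^ 2)) * σ) =
      quant σ * (D 1 ^ 4 + (2 : ℝ) • (D 0 * D 1 * D 2 ^ 2)) := by
  rw [add_mul, map_add, smul_mul_assoc, map_smul, quant_pow_mul_right quant_X_three_mul,
    show X 2 * X 3 * X 4 ^ 2 * σ = X 4 ^ 2 * (X 3 * (X 2 * σ)) by ring,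
    quant_pow_mul_right quant_X_four_mul, quant_X_three_mul, quant_X_two_mul, mul_add,
    mul_smul_comm]
  simp only [mul_assoc]

theorem quant_tau_three_mul (σ : MvPolynomial (Fin 5) ℝ) :
    quant (((3 : ℝ) • (X 3 ^ 3 * X 4 ^ 2) + X 2 * X 4 ^ 4) * σ) =
      quant σ * ((3 : ℝ) • (D 1 ^ 3 * D 2 ^ 2) + D 0 * D 2 ^ 4) := by
  rw [add_mul, map_add, smul_mul_assoc, map_smul,
    show X 3 ^ 3 * X 4 ^ 2 * σ = X 4 ^ 2 * (X 3 ^ 3 * σ) by ring,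
    show X 2 * X 4 ^ 4 * σ = X 4 ^ 4 * (X 2 * σ) by ring,
    quant_pow_mul_right quant_X_four_mul, quant_pow_mul_right quant_X_four_mul,
    quant_pow_mul_right quant_X_three_mul, quant_X_two_mul, mul_add, mul_smul_comm]
  simp only [mul_assoc]

@[to_additive]
theorem prod_univ_eleven {M : Type*} [CommMonoid M] (f : Fin 11 → M) :
    ∏ j, f j = f 0 * f 1 * f 2 * f 3 * f 4 * f 5 * f 6 * f 7 * f 8 * f 9 * f 10 := by
  rw [Fin.prod_univ_castSucc, Fin.prod_univ_castSucc, Fin.prod_univ_castSucc,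
    Fin.prod_univ_eight]
  rfl

theorem dOp_eq_quant (α : Fin 11 → ℕ) :
    dOp α = ((weight α)! : ℝ) • quant (divMon tau α) := by
  have h : divMon tau α = ((∏ j, ((α j)! : ℝ))⁻¹ *
      (2 ^ α 3 * 3 ^ (α 2 + α 3 + α 4 + 2 * α 5 + 2 * α 6 + α 9) * 7 ^ α 6)⁻¹) •
      (((3 : ℝ) • (X 3 ^ 3 * X 4 ^ 2) + X 2 * X 4 ^ 4) ^ α 3 *
        ((X 3 ^ 4 + (2 : ℝ) • (X 2 * X 3 * X 4 ^ 2)) ^ α 2 *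
        (X 4 ^ (2 * (2 * α 4 + 3 * α 5 + 4 * α 6 + α 8 + 2 * α 9 + α 10)) *
        (X 3 ^ (2 * (α 1 + α 4 + α 7) + α 5 + α 8) *
        (X 2 ^ (2 * α 0 + α 1) *
        (X 0 ^ (α 7 + α 8 + α 9) * (X 1 ^ α 10 * 1))))))) := by
    rw [divMon, Finset.prod_smul, mul_smul, Finset.prod_inv_distrib]
    congr 1
    generalize hU : (X 3 ^ 4 + (2 : ℝ) • (X 2 * X 3 * X 4 ^ 2) : MvPolynomial (Fin 5) ℝ) = U
    generalize hV : ((3 : ℝ) • (X 3 ^ 3 * X 4 ^ 2) + X 2 * X 4 ^ 4 : MvPolynomial (Fin 5) ℝ) = V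
    have hc : ((2 ^ α 3 * 3 ^ (α 2 + α 3 + α 4 + 2 * α 5 + 2 * α 6 + α 9) * 7 ^ α 6 : ℝ))⁻¹ =
        (1 / 3) ^ α 2 * (1 / 6) ^ α 3 * (1 / 3) ^ α 4 * (1 / 9) ^ α 5 * (1 / 63) ^ α 6 *
          (1 / 3) ^ α 9 := by
      rw [show (6 : ℝ) = 2 * 3 by norm_num, show (9 : ℝ) = 3 ^ 2 by norm_num,
        show (63 : ℝ) = 3 ^ 2 * 7 by norm_num]
      simp only [one_div, inv_pow, mul_pow, ← pow_mul, pow_add]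
      rw [← mul_inv, ← mul_inv, ← mul_inv, ← mul_inv, ← mul_inv]
      ring
    rw [hc]
    rw [prod_univ_eleven, show tau 0 = X 2 ^ 2 from rfl, show tau 1 = X 2 * X 3 ^ 2 from rfl,
      show tau 2 = (1 / 3 : ℝ) • U from hU ▸ rfl, show tau 3 = (1 / 6 : ℝ) • V from hV ▸ rfl,
      show tau 4 = (1 / 3 : ℝ) • (X 3 ^ 2 * X 4 ^ 4) from rfl,
      show tau 5 = (1 / 9 : ℝ) • (X 3 * X 4 ^ 6) from rfl,
      show tau 6 = (1 / 63 : ℝ) • X 4 ^ 8 from rfl, show tau 7 = X 0 * X 3 ^ 2 from rfl,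
      show tau 8 = X 0 * X 3 * X 4 ^ 2 from rfl,
      show tau 9 = (1 / 3 : ℝ) • (X 0 * X 4 ^ 4) from rfl,
      show tau 10 = X 1 * X 4 ^ 2 from rfl]
    simp only [smul_pow, smul_mul_assoc, mul_smul_comm, smul_smul]
    congr 1 <;> ring
  rw [h, dOp, map_smul, smul_smul, dCoeff, quant_pow_mul_right quant_tau_three_mul,
    quant_pow_mul_right quant_tau_two_mul, quant_pow_mul_right quant_X_four_mul,
    quant_pow_mul_right quant_X_three_mul, quant_pow_mul_right quant_X_two_mul,
    quant_pow_mul_left quant_X_zero_mul, quant_pow_mul_left quant_X_one_mul, quant_one, mul_one,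
    LinearMap.pow_mulLeft, LinearMap.pow_mulLeft,
    Module.End.mul_eq_comp (LinearMap.mulLeft ℝ _) (LinearMap.mulLeft ℝ _),
    ← LinearMap.mulLeft_mul]
  congr 1
  rw [div_div, div_eq_mul_inv, mul_inv]

/-- The sum of `d_α f` over the multi-indices of weight `k`. -/
noncomputable def weightSum (m₁ m₂ m₃ : ℕ) (k : ℕ) : Poly3 :=
  ∑ α ∈ level wt k, dMon m₁ m₂ m₃ α

theorem mem_level_iff_weight {k : ℕ} {α : Fin 11 → ℕ} : α ∈ level wt k ↔ weight α = k := by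
  rw [mem_level wt_pos, weight_eq_sum, Nat.cast_inj]

theorem weightSum_eq (m₁ m₂ m₃ k : ℕ) : weightSum m₁ m₂ m₃ k =
    (k ! : ℝ) • quant (expPart wt tau k) (X 0 ^ m₁ * X 1 ^ m₂ * X 2 ^ m₃) := by
  rw [weightSum, expPart, map_sum, LinearMap.sum_apply, Finset.smul_sum]
  refine Finset.sum_congr rfl fun α hα => ?_
  rw [mem_level_iff_weight] at hα
  rw [dMon, dOp_eq_quant, hα, LinearMap.smul_apply]

theorem weightSum_succ (m₁ m₂ m₃ k : ℕ) :
    weightSum m₁ m₂ m₃ (k + 1) = spatial (weightSum m₁ m₂ m₃ k) := by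
  rw [weightSum_eq, weightSum_eq, map_smul, ← Module.End.mul_apply, spatial_mul_quant_expPart,
    LinearMap.smul_apply, smul_smul, Nat.factorial_succ]
  push_cast
  rw [mul_comm]

/-- Polynomials of total degree less than `n`. -/
noncomputable def degreeLT (n : ℕ) : Submodule ℝ Poly3 :=
  restrictSupport ℝ {m : Fin 3 →₀ ℕ | m.degree < n}

theorem mem_degreeLT {n : ℕ} {p : Poly3} :
    p ∈ degreeLT n ↔ ∀ m : Fin 3 →₀ ℕ, n ≤ m.degree → coeff m p = 0 := by
  rw [degreeLT, mem_restrictSupport_iff]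
  constructor
  · intro h m hm
    by_contra hc
    exact absurd (h (mem_support_iff.2 hc)) (not_lt.2 hm)
  · intro h m hm
    by_contra hc
    exact (mem_support_iff.1 hm) (h m (not_lt.1 hc))

theorem D_mem_degreeLT {n : ℕ} {p : Poly3} (j : Fin 3) (hp : p ∈ degreeLT n) :
    D j p ∈ degreeLT (n - 1) := by
  rw [mem_degreeLT] at hp ⊢
  intro m hm
  rw [D, Derivation.coeFn_coe, coeff_pderiv, hp]
  · simp
  · rw [map_add, Finsupp.degree_single]
    omega

/-- `T` lowers the total degree by at least `k`. -/
def Lowers (k : ℕ) (T : Module.End ℝ Poly3) : Prop :=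
  ∀ n, ∀ p ∈ degreeLT n, T p ∈ degreeLT (n - k)

theorem lowers_D (j : Fin 3) : Lowers 1 (D j) := fun _ _ hp => D_mem_degreeLT j hp

theorem Lowers.mul {k l : ℕ} {S T : Module.End ℝ Poly3} (hS : Lowers k S) (hT : Lowers l T) :
    Lowers (k + l) (S * T) := fun n p hp => by
  rw [add_comm, ← Nat.sub_sub]
  exact hS _ _ (hT _ _ hp)

theorem Lowers.pow {k : ℕ} {T : Module.End ℝ Poly3} (hT : Lowers k T) (n : ℕ) :
    Lowers (n * k) (T ^ n) := by
  induction n with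
  | zero => intro n p hp; simpa using hp
  | succ n ih => rw [pow_succ, Nat.succ_mul]; exact ih.mul hT

theorem Lowers.add {k : ℕ} {S T : Module.End ℝ Poly3} (hS : Lowers k S) (hT : Lowers k T) :
    Lowers k (S + T) := fun n p hp => add_mem (hS n p hp) (hT n p hp)

theorem Lowers.smul {k : ℕ} {T : Module.End ℝ Poly3} (c : ℝ) (hT : Lowers k T) :
    Lowers k (c • T) := fun n p hp => Submodule.smul_mem _ c (hT n p hp)

theorem Lowers.apply_eq_zero {k : ℕ} {T : Module.End ℝ Poly3} (hT : Lowers k T) {p : Poly3}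
    (hp : p ∈ degreeLT k) : T p = 0 := by
  have h := hT k p hp
  rw [mem_degreeLT, Nat.sub_self] at h
  ext m
  simpa using h m (Nat.zero_le _)

theorem degreeLT_mono {m n : ℕ} (h : m ≤ n) : degreeLT m ≤ degreeLT n := fun p hp => by
  rw [mem_degreeLT] at hp ⊢
  exact fun s hs => hp s (h.trans hs)

theorem monomial_mem_degreeLT (m₁ m₂ m₃ : ℕ) :
    (X 0 ^ m₁ * X 1 ^ m₂ * X 2 ^ m₃ : Poly3) ∈ degreeLT (m₁ + m₂ + m₃ + 1) := by
  rw [mem_degreeLT]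
  intro m hm
  rw [X_pow_eq_monomial, X_pow_eq_monomial, X_pow_eq_monomial, monomial_mul, monomial_mul,
    coeff_monomial, if_neg]
  rintro rfl
  simp only [map_add, Finsupp.degree_single] at hm
  omega

theorem lowers_four : Lowers 4 (D 1 ^ 4 + (2 : ℝ) • (D 0 * D 1 * D 2 ^ 2)) := by
  have h1 := (lowers_D 1).pow 4
  have h2 := (((lowers_D 0).mul (lowers_D 1)).mul ((lowers_D 2).pow 2)).smul 2
  norm_num only at h1 h2
  exact h1.add h2

theorem lowers_five : Lowers 5 ((3 : ℝ) • (D 1 ^ 3 * D 2 ^ 2) + D 0 * D 2 ^ 4) := by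
  have h1 := (((lowers_D 1).pow 3).mul ((lowers_D 2).pow 2)).smul 3
  have h2 := (lowers_D 0).mul ((lowers_D 2).pow 4)
  norm_num only at h1 h2
  exact h1.add h2

theorem dMon_eq_zero {m₁ m₂ m₃ : ℕ} {α : Fin 11 → ℕ} (h : m₁ + m₂ + m₃ < ∑ j, α j) :
    dMon m₁ m₂ m₃ α = 0 := by
  have hL := (((((lowers_D 0).pow (2 * α 0 + α 1)).mul
    ((lowers_D 1).pow (2 * (α 1 + α 4 + α 7) + α 5 + α 8))).mul
    ((lowers_D 2).pow (2 * (2 * α 4 + 3 * α 5 + 4 * α 6 + α 8 + 2 * α 9 + α 10)))).mul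
    (lowers_four.pow (α 2))).mul (lowers_five.pow (α 3))
  have h0 := hL.apply_eq_zero (degreeLT_mono (by
    rw [sum_univ_eleven] at h
    omega) (monomial_mem_degreeLT m₁ m₂ m₃))
  rw [dMon, dOp, LinearMap.smul_apply]
  simp only [mul_assoc (LinearMap.mulLeft ℝ _)]
  rw [Module.End.mul_apply, h0, map_zero]
  exact smul_zero _

theorem finite_dMon_ne_zero (m₁ m₂ m₃ : ℕ) : {α | dMon m₁ m₂ m₃ α ≠ 0}.Finite := by
  refine (Fintype.piFinset fun _ : Fin 11 =>
    Finset.range (m₁ + m₂ + m₃ + 1)).finite_toSet.subset fun α hα => ?_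
  rw [Finset.mem_coe, Fintype.mem_piFinset]
  intro j
  rw [Finset.mem_range, Nat.lt_succ_iff]
  by_contra hlt
  exact hα (dMon_eq_zero ((not_le.1 hlt).trans_le
    (Finset.single_le_sum (f := α) (fun _ _ => Nat.zero_le _) (Finset.mem_univ j))))

theorem weight_le (α : Fin 11 → ℕ) : weight α ≤ 7 * ∑ j, α j := by
  rw [weight_eq_sum, Finset.mul_sum]
  refine Finset.sum_le_sum fun j _ => Nat.mul_le_mul_right _ ?_
  revert j
  decide

theorem weightSum_eq_zero {m₁ m₂ m₃ k : ℕ} (h : 7 * (m₁ + m₂ + m₃) < k) :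
    weightSum m₁ m₂ m₃ k = 0 := by
  refine Finset.sum_eq_zero fun α hα => dMon_eq_zero ?_
  rw [mem_level_iff_weight] at hα
  have h2 := weight_le α
  omega

/-- Summation of a function of the weight against `d_α f` by weights. -/
theorem finsum_weight_mul (m₁ m₂ m₃ : ℕ) (c : ℕ → ℝ) (v : Fin 3 → ℝ) :
    ∑ᶠ α, c (weight α) * eval v (dMon m₁ m₂ m₃ α) =
      ∑ k ∈ Finset.range (7 * (m₁ + m₂ + m₃) + 1), c k * eval v (weightSum m₁ m₂ m₃ k) := by
  rw [finsum_eq_sum_of_support_subset (s := (Finset.range (7 * (m₁ + m₂ + m₃) + 1)).biUnion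
    fun k => level wt k), Finset.sum_biUnion]
  · refine Finset.sum_congr rfl fun k _ => ?_
    rw [weightSum, map_sum, Finset.mul_sum]
    refine Finset.sum_congr rfl fun α hα => ?_
    rw [mem_level_iff_weight.1 hα]
  · intro k _ l _ hkl
    rw [Function.onFun, Finset.disjoint_left]
    intro α hk hl
    exact hkl ((mem_level_iff_weight.1 hk).symm.trans (mem_level_iff_weight.1 hl))
  · intro α hα
    simp only [Finset.coe_biUnion, Set.mem_iUnion, Finset.mem_coe, Finset.mem_range]
    refine ⟨weight α, ?_, mem_level_iff_weight.2 rfl⟩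
    by_contra hk
    refine hα ?_
    have h2 := weight_le α
    simp only
    rw [dMon_eq_zero (by omega), map_zero, mul_zero]

/-- The coefficient of `t^(n+1-r)` in `ξ_{b,n+1}`. -/
noncomputable def xiCoeff (b : ℂ) (n r : ℕ) : ℂ :=
  (-1) ^ r * (n + r)! / ((n + 1)! * (n - r)! * r ! * b ^ (r + n + 1))

/-- The polynomial `ξ_{b,i}`. -/
noncomputable def xiPoly (b : ℂ) : ℕ → Polynomial ℂ
  | 0 => 1
  | n + 1 => ∑ r ∈ Finset.range (n + 1), Polynomial.C (xiCoeff b n r) * Polynomial.X ^ (n + 1 - r)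

theorem factorial_mul_prod_Icc (n r : ℕ) :
    (n ! : ℂ) * ∏ s ∈ Finset.Icc 1 r, ((n : ℂ) + (s : ℂ)) = ((n + r)! : ℂ) := by
  induction r with
  | zero => simp
  | succ r ih =>
    rw [Finset.prod_Icc_succ_top (by omega), ← mul_assoc, ih, ← add_assoc n r 1,
      Nat.factorial_succ]
    push_cast
    ring

theorem xi_eq_eval (b : ℂ) (i : ℕ) (t : ℂ) : xi b i t = (xiPoly b i).eval t := by
  cases i with
  | zero => simp [xi, xiPoly]
  | succ n =>
    rw [xi, xiPoly, Finset.sum_range_succ', Nat.add_sub_cancel, Polynomial.eval_add,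
      Polynomial.eval_finsetSum, add_comm, Finset.range_eq_Ico,
      Finset.sum_Ico_add' (fun r => Polynomial.eval t (Polynomial.C (xiCoeff b n r) *
        Polynomial.X ^ (n + 1 - r))) 0 n 1, zero_add, Finset.Ico_add_one_right_eq_Icc]
    congr 1
    · refine Finset.sum_congr rfl fun r hr => ?_
      obtain ⟨h1, h2⟩ := Finset.mem_Icc.1 hr
      obtain ⟨r, rfl⟩ : ∃ s, r = s + 1 := ⟨r - 1, by omega⟩
      have h := factorial_mul_prod_Icc (n + 1) r
      have h0 : ((n + 1)! : ℂ) ≠ 0 := by exact_mod_cast (n + 1).factorial_ne_zero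
      rw [Polynomial.eval_mul, Polynomial.eval_C, Polynomial.eval_pow, Polynomial.eval_X, xiCoeff,
        show n + (r + 1) = n + 1 + r by ring, ← h, Nat.add_sub_cancel,
        show n + 1 - (r + 1) - 1 = n - (r + 1) by omega,
        show r + 1 + (n + 1) = r + 1 + n + 1 by ring]
      congr 1
      rw [mul_left_comm, mul_assoc, mul_assoc, mul_assoc, mul_div_mul_left _ _ h0]
    · have h0 : (n ! : ℂ) ≠ 0 := by exact_mod_cast n.factorial_ne_zero
      simp only [xiCoeff, Polynomial.eval_mul, Polynomial.eval_C, Polynomial.eval_pow,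
        Polynomial.eval_X, pow_zero, one_mul, add_zero, Nat.sub_zero, Nat.factorial_zero,
        Nat.cast_one, mul_one, zero_add]
      rw [mul_right_comm, mul_comm _ (n ! : ℂ), ← div_div (n ! : ℂ), div_self h0]
      ring

theorem xiCoeff_zero {b : ℂ} (hb : b ≠ 0) (n : ℕ) :
    b * xiCoeff b (n + 1) 0 * (n + 2) = xiCoeff b n 0 := by
  have h0 : (n ! : ℂ) ≠ 0 := by exact_mod_cast n.factorial_ne_zero
  have h1 : (n + 1 : ℂ) ≠ 0 := by exact_mod_cast n.succ_ne_zero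
  have h2 : (n + 2 : ℂ) ≠ 0 := by exact_mod_cast (n + 1).succ_ne_zero
  simp only [xiCoeff, Nat.sub_zero, add_zero, Nat.factorial_succ]
  push_cast
  rw [show (n : ℂ) + 1 + 1 = n + 2 by ring]
  field_simp
  simp [pow_succ']

theorem xiCoeff_succ {b : ℂ} (hb : b ≠ 0) (r k : ℕ) :
    xiCoeff b (r + 1 + k + 1) r * (k + 3) * (k + 2) +
      b * xiCoeff b (r + 1 + k + 1) (r + 1) * (k + 2) = xiCoeff b (r + 1 + k) (r + 1) := by
  have h0 : (k ! : ℂ) ≠ 0 := by exact_mod_cast k.factorial_ne_zero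
  have h0' : (r ! : ℂ) ≠ 0 := by exact_mod_cast r.factorial_ne_zero
  have h0'' : ((r + 1 + k)! : ℂ) ≠ 0 := by exact_mod_cast (r + 1 + k).factorial_ne_zero
  have h1 : (k + 1 : ℂ) ≠ 0 := by exact_mod_cast k.succ_ne_zero
  have h2 : (k + 2 : ℂ) ≠ 0 := by exact_mod_cast (k + 1).succ_ne_zero
  have h3 : (r + 1 : ℂ) ≠ 0 := by exact_mod_cast r.succ_ne_zero
  have h4 : (r + 1 + k + 1 : ℂ) ≠ 0 := by exact_mod_cast (r + 1 + k).succ_ne_zero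
  have h5 : (r + 1 + k + 1 + 1 : ℂ) ≠ 0 := by exact_mod_cast (r + 1 + k + 1).succ_ne_zero
  simp only [xiCoeff, show r + 1 + k + 1 - r = k + 1 + 1 by omega,
    show r + 1 + k + 1 - (r + 1) = k + 1 by omega, show r + 1 + k - (r + 1) = k by omega,
    show r + 1 + k + 1 + r = r + 1 + k + (r + 1) by ring,
    show r + 1 + k + 1 + (r + 1) = r + 1 + k + (r + 1) + 1 by ring,
    show r + (r + 1 + k + 1) + 1 = 2 * r + k + 3 by ring,
    show r + 1 + (r + 1 + k + 1) + 1 = 2 * r + k + 4 by ring,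
    show r + 1 + (r + 1 + k) + 1 = 2 * r + k + 3 by ring, Nat.factorial_succ]
  generalize ((r + 1 + k + (r + 1))! : ℕ) = F
  push_cast
  rw [show (k : ℂ) + 1 + 1 = k + 2 by ring, pow_succ b (2 * r + k + 3), pow_succ (-1 : ℂ)]
  field_simp
  ring

theorem xiCoeff_last {b : ℂ} (hb : b ≠ 0) (m : ℕ) :
    xiCoeff b (m + 1) m * 2 + b * xiCoeff b (m + 1) (m + 1) = 0 := by
  have h0' : (m ! : ℂ) ≠ 0 := by exact_mod_cast m.factorial_ne_zero
  have h3 : (m + 1 : ℂ) ≠ 0 := by exact_mod_cast m.succ_ne_zero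
  have h4 : (m + 1 + 1 : ℂ) ≠ 0 := by exact_mod_cast (m + 1).succ_ne_zero
  simp only [xiCoeff, show m + 1 - m = 1 by omega, Nat.sub_self,
    show m + 1 + (m + 1) = m + 1 + m + 1 by ring,
    show m + (m + 1) + 1 = 2 * m + 2 by ring,
    show m + 1 + m + 1 + 1 = 2 * m + 2 + 1 by ring, Nat.factorial_succ (m + 1 + m),
    Nat.factorial_succ m, Nat.factorial_succ (m + 1), Nat.factorial_zero, Nat.factorial_one]
  generalize ((m + 1 + m)! : ℕ) = F
  push_cast
  rw [pow_succ b (2 * m + 2), pow_succ (-1 : ℂ)]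
  field_simp
  ring

theorem xiPoly_ode {b : ℂ} (hb : b ≠ 0) (n : ℕ) :
    (xiPoly b (n + 1)).derivative.derivative + Polynomial.C b * (xiPoly b (n + 1)).derivative =
      xiPoly b n := by
  cases n with
  | zero =>
    have : b * xiCoeff b 0 0 = 1 := by simp [xiCoeff, hb]
    simp [xiPoly, ← Polynomial.C_mul, this]
  | succ n =>
    have h1 : (xiPoly b (n + 2)).derivative = ∑ r ∈ Finset.range (n + 2),
        Polynomial.C (xiCoeff b (n + 1) r * ((n + 2 - r : ℕ) : ℂ)) *
          Polynomial.X ^ (n + 1 - r) := by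
      rw [xiPoly, Polynomial.derivative_sum]
      refine Finset.sum_congr rfl fun r _ => ?_
      rw [Polynomial.derivative_C_mul_X_pow, show n + 1 + 1 - r - 1 = n + 1 - r by omega]
    have h2 : (xiPoly b (n + 2)).derivative.derivative = ∑ r ∈ Finset.range (n + 1),
        Polynomial.C (xiCoeff b (n + 1) r * ((n + 2 - r : ℕ) : ℂ) * ((n + 1 - r : ℕ) : ℂ)) *
          Polynomial.X ^ (n - r) := by
      rw [h1, Polynomial.derivative_sum, Finset.sum_range_succ]
      simp only [Polynomial.derivative_C_mul_X_pow, Nat.sub_self, Nat.cast_zero, mul_zero,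
        Polynomial.C_0, zero_mul, add_zero]
      refine Finset.sum_congr rfl fun r _ => ?_
      rw [show n + 1 - r - 1 = n - r by omega]
    rw [h2, h1, Finset.sum_range_succ' _ (n + 1), mul_add, Finset.mul_sum, ← add_assoc,
      ← Finset.sum_add_distrib, Finset.sum_range_succ, xiPoly, Finset.sum_range_succ' _ n]
    have hlast : xiCoeff b (n + 1) n * ((n + 2 - n : ℕ) : ℂ) * ((n + 1 - n : ℕ) : ℂ) +
        b * (xiCoeff b (n + 1) (n + 1) * ((n + 2 - (n + 1) : ℕ) : ℂ)) = 0 := by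
      rw [show n + 2 - n = 2 by omega, show n + 1 - n = 1 by omega,
        show n + 2 - (n + 1) = 1 by omega, ← xiCoeff_last hb n]
      push_cast
      ring
    have hz : b * (xiCoeff b (n + 1) 0 * ((n + 2 - 0 : ℕ) : ℂ)) = xiCoeff b n 0 := by
      rw [← xiCoeff_zero hb n, Nat.sub_zero]
      push_cast
      ring
    simp only [Nat.add_sub_add_right, ← mul_assoc, ← Polynomial.C_mul, ← add_mul,
      ← Polynomial.C_add] at hlast hz ⊢
    rw [hlast, hz, Polynomial.C_0, zero_mul, add_zero]
    congr 1
    refine Finset.sum_congr rfl fun r hr => ?_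
    obtain ⟨k, rfl⟩ : ∃ k, n = r + 1 + k :=
      ⟨n - (r + 1), by have := Finset.mem_range.1 hr; omega⟩
    rw [← xiCoeff_succ hb, show r + 1 + k + 2 - r = k + 3 by omega,
      show r + 1 + k + 1 - r = k + 2 by omega,
      show r + 1 + k + 2 - (r + 1) = k + 2 by omega]
    push_cast
    rfl

theorem exists_re_im (p : Polynomial ℂ) : ∃ A B : Polynomial ℝ,
    p = A.map Complex.ofRealHom + Polynomial.C Complex.I * B.map Complex.ofRealHom := by
  induction p using Polynomial.induction_on' with
  | add p q hp hq =>
    obtain ⟨A, B, rfl⟩ := hp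
    obtain ⟨A', B', rfl⟩ := hq
    refine ⟨A + A', B + B', ?_⟩
    rw [Polynomial.map_add, Polynomial.map_add]
    ring
  | monomial n c =>
    refine ⟨Polynomial.monomial n c.re, Polynomial.monomial n c.im, ?_⟩
    rw [Polynomial.map_monomial, Polynomial.map_monomial, Polynomial.C_mul_monomial,
      ← map_add]
    congr 1
    simp [mul_comm Complex.I, Complex.re_add_im]

theorem eval_map_ofReal (A : Polynomial ℝ) (t : ℝ) :
    (A.map Complex.ofRealHom).eval (t : ℂ) = ((A.eval t : ℝ) : ℂ) := by
  rw [← Complex.ofRealHom_eq_coe, Polynomial.eval_map_apply]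
  rfl

theorem exists_zeta_poly {a : ℝ} (ha : a ≠ 0) : ∃ A B : ℕ → Polynomial ℝ,
    (∀ i t, zeta0 a i t = (A i).eval t) ∧ (∀ i t, zeta1 a i t = (B i).eval t) ∧
    A 0 = 1 ∧ B 0 = 0 ∧
    (∀ i t, (A (i + 1)).derivative.derivative.eval t -
      2 * a * (B (i + 1)).derivative.eval t = (A i).eval t) ∧
    ∀ i t, (B (i + 1)).derivative.derivative.eval t +
      2 * a * (A (i + 1)).derivative.eval t = (B i).eval t := by
  have hb : 2 * (a : ℂ) * Complex.I ≠ 0 := by simp [ha]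
  choose A B hAB using fun i => exists_re_im (xiPoly (2 * (a : ℂ) * Complex.I) i)
  have hx : ∀ (i : ℕ) (t : ℝ), xi (2 * (a : ℂ) * Complex.I) i (t : ℂ) =
      ((A i).eval t : ℝ) + Complex.I * ((B i).eval t : ℝ) := by
    intro i t
    rw [xi_eq_eval, hAB, Polynomial.eval_add, Polynomial.eval_mul, Polynomial.eval_C,
      eval_map_ofReal, eval_map_ofReal]
  have h0 : ∀ i t, zeta0 a i t = (A i).eval t := fun i t => by simp [zeta0, hx]
  have h1 : ∀ i t, zeta1 a i t = (B i).eval t := fun i t => by simp [zeta1, hx]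
  have hode : ∀ (i : ℕ) (t : ℝ),
      (((A (i + 1)).derivative.derivative.eval t : ℝ) : ℂ) +
        Complex.I * ((B (i + 1)).derivative.derivative.eval t : ℝ) +
        2 * a * Complex.I * (((A (i + 1)).derivative.eval t : ℝ) +
          Complex.I * ((B (i + 1)).derivative.eval t : ℝ)) =
      ((A i).eval t : ℝ) + Complex.I * ((B i).eval t : ℝ) := by
    intro i t
    have h := congrArg (Polynomial.eval (t : ℂ)) (xiPoly_ode hb i)
    rw [hAB, hAB] at h
    simpa only [Polynomial.derivative_add, Polynomial.derivative_C_mul, Polynomial.derivative_map,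
      Polynomial.eval_add, Polynomial.eval_mul, Polynomial.eval_C, eval_map_ofReal] using h
  refine ⟨A, B, h0, h1, ?_, ?_, ?_, ?_⟩
  · refine Polynomial.funext fun t => ?_
    rw [← h0]
    simp [zeta0, xi]
  · refine Polynomial.funext fun t => ?_
    rw [← h1]
    simp [zeta1, xi]
  · intro i t
    have h := congrArg Complex.re (hode i t)
    simp at h
    linarith
  · intro i t
    have h := congrArg Complex.im (hode i t)
    simp at h
    linarith

theorem iteratedDeriv_two_eq {f g h : ℝ → ℝ} (hf : ∀ s, HasDerivAt f (g s) s)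
    (hg : ∀ s, HasDerivAt g (h s) s) : iteratedDeriv 2 f = h := by
  have h1 : deriv f = g := funext fun s => (hf s).deriv
  have h2 : deriv g = h := funext fun s => (hg s).deriv
  rw [iteratedDeriv_succ, iteratedDeriv_one, h1, h2]

theorem hasDerivAt_eval {σ : Type*} [DecidableEq σ] (p : MvPolynomial σ ℝ) (j : σ) (v : σ → ℝ)
    (s : ℝ) : HasDerivAt (fun s => eval (Function.update v j s) p)
      (eval (Function.update v j s) (pderiv j p)) s := by
  induction p using MvPolynomial.induction_on with
  | C c => simpa using hasDerivAt_const s c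
  | add p q hp hq => simpa using hp.fun_add hq
  | mul_X p i hp =>
    have hX : HasDerivAt (fun s => Function.update v j s i)
        (if j = i then 1 else 0) s := by
      by_cases h : j = i
      · subst h
        simpa using hasDerivAt_id' s
      · simpa [h, Function.update_of_ne (Ne.symm h)] using hasDerivAt_const s (v i)
    have h := hp.mul hX
    simp only [map_mul, eval_X, pderiv_mul, map_add, pderiv_X]
    refine h.congr_deriv ?_
    by_cases hij : j = i
    · subst hij
      simp
    · simp [hij]

theorem contDiff_eval {σ E : Type*} [NormedAddCommGroup E] [NormedSpace ℝ E]
    (p : MvPolynomial σ ℝ) {v : E → σ → ℝ} (hv : ∀ i, ContDiff ℝ ∞ fun e => v e i) :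
    ContDiff ℝ ∞ fun e => eval (v e) p := by
  induction p using MvPolynomial.induction_on with
  | C c => simpa using contDiff_const
  | add p q hp hq => simpa using hp.add hq
  | mul_X p i hp => simpa using hp.mul (hv i)

theorem eval_spatial (x y z : ℝ) (p : Poly3) :
    eval ![x, y, z] (spatial p) = eval ![x, y, z] (D 0 (D 0 p)) +
      x * eval ![x, y, z] (D 1 (D 1 p)) + y * eval ![x, y, z] (D 2 (D 2 p)) := by
  simp [spatial, pow_two]

theorem iteratedDeriv_two_sum_eval (s : Finset ℕ) (c : ℕ → ℝ) (p : ℕ → Poly3) (j : Fin 3)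
    (v : Fin 3 → ℝ) : iteratedDeriv 2 (fun r => ∑ k ∈ s, c k * eval (Function.update v j r) (p k)) =
      fun r => ∑ k ∈ s, c k * eval (Function.update v j r) (D j (D j (p k))) :=
  iteratedDeriv_two_eq
    (fun r => HasDerivAt.fun_sum fun k _ => (hasDerivAt_eval (p k) j v r).const_mul (c k))
    (fun r => HasDerivAt.fun_sum fun k _ =>
      (hasDerivAt_eval (D j (p k)) j v r).const_mul (c k))

theorem isSolution_sum {a : ℝ} {c c₁ c₂ : ℕ → ℝ → ℝ}
    (hc : ∀ k t, HasDerivAt (c k) (c₁ k t) t) (hc₁ : ∀ k t, HasDerivAt (c₁ k) (c₂ k t) t)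
    (hsmooth : ∀ k, ContDiff ℝ ∞ (c k)) (hzero : ∀ t, c₂ 0 t + a ^ 2 * c 0 t = 0)
    (hsucc : ∀ k t, c₂ (k + 1) t + a ^ 2 * c (k + 1) t = c k t)
    {p : ℕ → Poly3} (hp : ∀ k, p (k + 1) = spatial (p k)) {n : ℕ} (hn : p (n + 1) = 0) :
    IsSolution a fun t x y z => ∑ k ∈ Finset.range (n + 1), c k t * eval ![x, y, z] (p k) := by
  refine ⟨ContDiff.sum fun k _ => ContDiff.mul ((hsmooth k).comp contDiff_fst)
    (contDiff_eval (p k) ?_), fun t x y z => ?_⟩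
  · intro i
    fin_cases i
    · exact contDiff_fst.comp contDiff_snd
    · exact contDiff_fst.comp (contDiff_snd.comp contDiff_snd)
    · exact contDiff_snd.comp (contDiff_snd.comp contDiff_snd)
  · have ht : iteratedDeriv 2
        (fun s => ∑ k ∈ Finset.range (n + 1), c k s * eval ![x, y, z] (p k)) =
        fun s => ∑ k ∈ Finset.range (n + 1), c₂ k s * eval ![x, y, z] (p k) :=
      iteratedDeriv_two_eq
        (fun s => HasDerivAt.fun_sum fun k _ => (hc k s).mul_const _)
        (fun s => HasDerivAt.fun_sum fun k _ => (hc₁ k s).mul_const _)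
    have hspace := fun j => iteratedDeriv_two_sum_eval (Finset.range (n + 1)) (fun k => c k t) p j
      ![x, y, z]
    have hx : ∀ s, Function.update ![x, y, z] 0 s = ![s, y, z] := fun s => by
      ext i; fin_cases i <;> simp
    have hy : ∀ s, Function.update ![x, y, z] 1 s = ![x, s, z] := fun s => by
      ext i; fin_cases i <;> simp
    have hz : ∀ s, Function.update ![x, y, z] 2 s = ![x, y, s] := fun s => by
      ext i; fin_cases i <;> simp
    have h0 := hspace 0
    have h1 := hspace 1
    have h2 := hspace 2
    simp only [hx, hy, hz] at h0 h1 h2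
    rw [ht, h0, h1, h2]
    have hL : ∑ k ∈ Finset.range (n + 1), (c₂ k t + a ^ 2 * c k t) * eval ![x, y, z] (p k) =
        ∑ k ∈ Finset.range (n + 1), c k t * eval ![x, y, z] (p (k + 1)) := by
      rw [Finset.sum_range_succ', Finset.sum_range_succ, hzero, hn]
      simp [hsucc]
    simp only [hp, eval_spatial, add_mul, mul_add, Finset.sum_add_distrib] at hL
    simp only [Finset.mul_sum] at hL ⊢
    simp only [mul_left_comm, mul_assoc] at hL ⊢
    linarith

theorem isSolution_rotation {a : ℝ} {A B : ℕ → Polynomial ℝ} (hA0 : A 0 = 1) (hB0 : B 0 = 0)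
    (hA : ∀ i t, (A (i + 1)).derivative.derivative.eval t -
      2 * a * (B (i + 1)).derivative.eval t = (A i).eval t)
    (hB : ∀ i t, (B (i + 1)).derivative.derivative.eval t +
      2 * a * (A (i + 1)).derivative.eval t = (B i).eval t)
    {C S : ℝ → ℝ} (hC : ∀ t, HasDerivAt C (-(a * S t)) t) (hS : ∀ t, HasDerivAt S (a * C t) t)
    (hC' : ContDiff ℝ ∞ C) (hS' : ContDiff ℝ ∞ S)
    {p : ℕ → Poly3} (hp : ∀ k, p (k + 1) = spatial (p k)) {n : ℕ} (hn : p (n + 1) = 0) :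
    IsSolution a fun t x y z =>
      C t * ∑ k ∈ Finset.range (n + 1), (A k).eval t * eval ![x, y, z] (p k) -
        S t * ∑ k ∈ Finset.range (n + 1), (B k).eval t * eval ![x, y, z] (p k) := by
  have hpoly : ∀ R : Polynomial ℝ, ContDiff ℝ ∞ fun t => R.eval t := fun R => by
    simpa only [Polynomial.coe_aeval_eq_eval] using R.contDiff_aeval (𝕜 := ℝ) ∞
  have h := isSolution_sum (a := a) (n := n) (p := p)
    (c := fun k t => C t * (A k).eval t - S t * (B k).eval t)
    (c₁ := fun k t => C t * ((A k).derivative.eval t - a * (B k).eval t) -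
      S t * (a * (A k).eval t + (B k).derivative.eval t))
    (c₂ := fun k t => C t * ((A k).derivative.derivative.eval t -
        2 * a * (B k).derivative.eval t - a ^ 2 * (A k).eval t) -
      S t * ((B k).derivative.derivative.eval t +
        2 * a * (A k).derivative.eval t - a ^ 2 * (B k).eval t))
    (fun k t => (((hC t).fun_mul ((A k).hasDerivAt t)).fun_sub
      ((hS t).fun_mul ((B k).hasDerivAt t))).congr_deriv (by ring))
    (fun k t => (((hC t).fun_mul (((A k).derivative.hasDerivAt t).fun_sub
      (((B k).hasDerivAt t).const_mul a))).fun_sub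
      ((hS t).fun_mul ((((A k).hasDerivAt t).const_mul a).fun_add
        ((B k).derivative.hasDerivAt t)))).congr_deriv (by ring))
    (fun k => (hC'.mul (hpoly _)).sub (hS'.mul (hpoly _)))
    (fun t => by simp [hA0, hB0]; ring)
    (fun k t => by simp only [← hA, ← hB]; ring) hp hn
  convert h using 5 with t x y z
  rw [Finset.mul_sum, Finset.mul_sum, ← Finset.sum_sub_distrib]
  exact Finset.sum_congr rfl fun k _ => by ring

end KleinGordon

theorem theorem2p6 (a : ℝ) (ha : a ≠ 0) (m₁ m₂ m₃ : ℕ) :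
    {α : Fin 11 → ℕ | KleinGordon.dMon m₁ m₂ m₃ α ≠ 0}.Finite ∧
    (∃ p q : MvPolynomial (Fin 4) ℝ, ∀ t x y z : ℝ,
      KleinGordon.P a m₁ m₂ m₃ t x y z = MvPolynomial.eval ![t, x, y, z] p ∧
      KleinGordon.Q a m₁ m₂ m₃ t x y z = MvPolynomial.eval ![t, x, y, z] q) ∧
    KleinGordon.IsSolution a (fun t x y z =>
      Real.cos (a * t) * KleinGordon.P a m₁ m₂ m₃ t x y z -
        Real.sin (a * t) * KleinGordon.Q a m₁ m₂ m₃ t x y z) ∧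
    KleinGordon.IsSolution a (fun t x y z =>
      Real.sin (a * t) * KleinGordon.P a m₁ m₂ m₃ t x y z +
        Real.cos (a * t) * KleinGordon.Q a m₁ m₂ m₃ t x y z) := by
  open KleinGordon in
  obtain ⟨A, B, hA, hB, hA0, hB0, hAode, hBode⟩ := exists_zeta_poly ha
  set n := 7 * (m₁ + m₂ + m₃) with hn
  have hP : ∀ t x y z, P a m₁ m₂ m₃ t x y z = ∑ k ∈ Finset.range (n + 1),
      (A k).eval t * eval ![x, y, z] (weightSum m₁ m₂ m₃ k) := fun t x y z => by
    simp only [P, ← hA]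
    exact finsum_weight_mul m₁ m₂ m₃ (fun k => zeta0 a k t) _
  have hQ : ∀ t x y z, Q a m₁ m₂ m₃ t x y z = ∑ k ∈ Finset.range (n + 1),
      (B k).eval t * eval ![x, y, z] (weightSum m₁ m₂ m₃ k) := fun t x y z => by
    simp only [Q, ← hB]
    exact finsum_weight_mul m₁ m₂ m₃ (fun k => zeta1 a k t) _
  have hlast : weightSum m₁ m₂ m₃ (n + 1) = 0 := weightSum_eq_zero (Nat.lt_succ_self _)
  have hcos : ∀ t, HasDerivAt (fun t => Real.cos (a * t)) (-(a * Real.sin (a * t))) t := fun t => by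
    simpa [mul_comm] using ((hasDerivAt_id t).const_mul a).cos
  have hsin : ∀ t, HasDerivAt (fun t => Real.sin (a * t)) (a * Real.cos (a * t)) t := fun t => by
    simpa [mul_comm] using ((hasDerivAt_id t).const_mul a).sin
  have hcos' : ContDiff ℝ ∞ fun t => Real.cos (a * t) :=
    Real.contDiff_cos.comp (contDiff_const.mul contDiff_id)
  have hsin' : ContDiff ℝ ∞ fun t => Real.sin (a * t) :=
    Real.contDiff_sin.comp (contDiff_const.mul contDiff_id)
  refine ⟨finite_dMon_ne_zero m₁ m₂ m₃, ?_, ?_, ?_⟩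
  · have h : ∀ (R : ℕ → Polynomial ℝ) (t x y z : ℝ), ∑ k ∈ Finset.range (n + 1),
        (R k).eval t * eval ![x, y, z] (weightSum m₁ m₂ m₃ k) =
        eval ![t, x, y, z] (∑ k ∈ Finset.range (n + 1), Polynomial.aeval (X 0) (R k) *
          rename Fin.succ (weightSum m₁ m₂ m₃ k)) := by
      intro R t x y z
      rw [map_sum]
      refine Finset.sum_congr rfl fun k _ => ?_
      have hR : eval ![t, x, y, z] (Polynomial.aeval (X 0) (R k)) = (R k).eval t := by
        rw [← coe_aeval_eq_eval, RingHom.coe_coe, ← Polynomial.aeval_algHom_apply, aeval_X]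
        rfl
      rw [map_mul, eval_rename, hR]
      rfl
    exact ⟨_, _, fun t x y z => ⟨(hP t x y z).trans (h A t x y z),
      (hQ t x y z).trans (h B t x y z)⟩⟩
  · simp only [hP, hQ]
    exact isSolution_rotation hA0 hB0 hAode hBode hcos hsin hcos' hsin'
      (weightSum_succ m₁ m₂ m₃) hlast
  · simp only [hP, hQ]
    have h := isSolution_rotation (C := fun t => Real.sin (a * t))
      (S := fun t => -Real.cos (a * t)) hA0 hB0 hAode hBode
      (fun t => (hsin t).congr_deriv (by ring)) (fun t => (hcos t).fun_neg.congr_deriv (by ring))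
      hsin' hcos'.neg (weightSum_succ m₁ m₂ m₃) hlast
    simpa only [neg_mul, sub_neg_eq_add] using h
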